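/- Let $H\in(\tfrac12,1)$, let $(\beta^H(t))_{t\ge 0}$ be a real-valued fractional Brownian motion with Hurst index $H$ (a centered Gaussian process with continuous paths and covariance $\tfrac12(s^{2H}+t^{2H}-|t-s|^{2H})$), and let $(B(t))_{t\ge 0}$ be a standard real-valued Brownian motion independent of $\beta^H$, both defined on a probability space $(\Omega,\mathcal F,\mathbb P)$. Let $\mathcal F^H=\sigma\{\beta^H(t);\,t\ge 0\}$ and $\mathbb E^H[\cdot]=\mathbb E[\cdot\,|\,\mathcal F^H]$. Let $g:\mathbb R^2\to\mathbb R$ be of class $\mathcal C^3$ with bounded derivatives of order $1,2,3$, let $\overline g(x)=\int g(x,m)\,d\nu(m)$ with $\nu=\mathcal N(0,1)$, and let $x_0\in\mathbb R$. Let $T\in(0,\infty)$ and let the time-step size be $\Delta t=T/N$ with $N\in\mathbb N$, $N\ge 1$. Set $t_n=n\Delta t$, $\delta\beta_n^H=\beta^H(t_{n+1})-\beta^H(t_n)$ and $\gamma_n=\Delta t^{-1/2}\bigl(B(t_{n+1})-B(t_n)\bigr)$. Define the limiting scheme by $$X_{n+1}^0=X_n^0+g(X_n^0,\gamma_n)\,\delta\beta_n^H,\qquad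 X_0^0=x_0,$$ and the Euler scheme for the averaged equation $d\overline X(t)=\overline g(\overline X(t))\,d\beta^H(t)$ by $$\overline X_{n+1}=\overline X_n+\overline g(\overline X_n)\,\delta\beta_n^H,\qquad \overline X_0=x_0.$$ Then, for every $\varphi:\mathbb R\to\mathbb R$ of class $\mathcal C_b^3$ (three times continuously differentiable, bounded, with bounded derivatives of order $1,2,3$), $$\lim_{\Delta t\to 0}\ \mathbb E\Bigl[\bigl|\mathbb E^H[\varphi(X_N^0)]-\varphi(\overline X_N)\bigr|\Bigr]=0,$$ where $\Delta t\to 0$ along $\Delta t=T/N$, that is, $N\to\infty$. -/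

import Mathlib

open MeasureTheory ProbabilityTheory Filter Topology
open scoped NNReal

noncomputable section

namespace FBMAveraging

/-- Fractional Brownian motion with Hurst index `H`: a centered Gaussian process, with covariance
`(s ^ (2H) + t ^ (2H) - |t - s| ^ (2H)) / 2` and almost surely continuous paths. -/
structure IsFractionalBrownian {Ω : Type*} [MeasurableSpace Ω] (H : ℝ) (β : ℝ≥0 → Ω → ℝ)
    (P : Measure Ω) : Prop where
  measurable : ∀ t, Measurable (β t)
  gaussian : IsGaussianProcess β P
  centered : ∀ t, ∫ ω, β t ω ∂P = 0
  covariance_eq : ∀ s t : ℝ≥0, covariance (β s) (β t) P =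
    ((s : ℝ) ^ (2 * H) + (t : ℝ) ^ (2 * H) - |(t : ℝ) - s| ^ (2 * H)) / 2
  cont : ∀ᵐ ω ∂P, Continuous (fun t => β t ω)

/-- The `σ`-field `σ{β(t) ; t ≥ 0}` generated by a real-valued process. -/
abbrev generatedSigma {Ω : Type*} (β : ℝ≥0 → Ω → ℝ) : MeasurableSpace Ω :=
  ⨆ t, MeasurableSpace.comap (β t) inferInstance

/-- Real functions of class `C_b^K`: bounded, `K` times continuously differentiable, with bounded
derivatives of order `1, …, K`. -/
def IsCb (K : ℕ) (φ : ℝ → ℝ) : Prop :=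
  ContDiff ℝ K φ ∧ ∀ k ≤ K, ∃ C : ℝ, ∀ x, |iteratedDeriv k φ x| ≤ C

/-- Functions on the plane of class `C^3`, with bounded derivatives of order `1, 2, 3`
(the function itself need not be bounded). -/
def IsAdmissibleCoeff (g : ℝ × ℝ → ℝ) : Prop :=
  ContDiff ℝ 3 g ∧ ∀ k : ℕ, 1 ≤ k → k ≤ 3 → ∃ C : ℝ, ∀ z, ‖iteratedFDeriv ℝ k g z‖ ≤ C

/-- The averaged coefficient: the second variable is integrated against the standard Gaussian
distribution. -/
def averagedCoeff (g : ℝ × ℝ → ℝ) (x : ℝ) : ℝ :=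
  ∫ m, g (x, m) ∂(gaussianReal 0 1)

/-- The increment over the `n`-th time step of size `Δt`. -/
def increment {Ω : Type*} (Y : ℝ≥0 → Ω → ℝ) (Δt : ℝ≥0) (n : ℕ) (ω : Ω) : ℝ :=
  Y ((n + 1) * Δt) ω - Y (n * Δt) ω

/-- The normalized Brownian increment `γ_n = Δt ^ (-1/2) * (B (t_{n+1}) - B (t_n))`. -/
def normalizedIncrement {Ω : Type*} (B : ℝ≥0 → Ω → ℝ) (Δt : ℝ≥0) (n : ℕ) (ω : Ω) : ℝ :=
  (√(Δt : ℝ))⁻¹ * increment B Δt n ω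

/-- The limiting scheme `X_{n+1} = X_n + g (X_n, γ_n) δβ_n`, `X_0 = x₀`. -/
def limitScheme {Ω : Type*} (g : ℝ × ℝ → ℝ) (β B : ℝ≥0 → Ω → ℝ) (x₀ : ℝ) (Δt : ℝ≥0) :
    ℕ → Ω → ℝ
  | 0, _ => x₀
  | n + 1, ω => limitScheme g β B x₀ Δt n ω +
      g (limitScheme g β B x₀ Δt n ω, normalizedIncrement B Δt n ω) * increment β Δt n ω

/-- The Euler scheme for the averaged equation. -/
def averagedScheme {Ω : Type*} (g : ℝ × ℝ → ℝ) (β : ℝ≥0 → Ω → ℝ) (x₀ : ℝ) (Δt : ℝ≥0) :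
    ℕ → Ω → ℝ
  | 0, _ => x₀
  | n + 1, ω => averagedScheme g β x₀ Δt n ω +
      averagedCoeff g (averagedScheme g β x₀ Δt n ω) * increment β Δt n ω

end FBMAveraging

end

noncomputable section

namespace FBMAveraging

/-! ### Global flows of Lipschitz vector fields on the line -/

/-! Given `β`, its path is frozen and only the independent Gaussian noise is averaged, so the
estimate can be made path by path. In dimension one the averaged equation is solved by running the
flow ψ of the field ḡ for the time β(t) - β(0), as in the Doss–Sussmann representation. Both schemes
are compared with the same value φ(ψ(x₀, β(T) - β(0))).

For one step with increment b, the mean of f(x + g(x, γ) b) differs from f(ψ(x, b)) by O(b² (1 +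
|x|)), because the first-order noise term has mean zero (`IsNoisyCoeff.exists_abs_integral_sub_le`).
Telescoping the means of φ(ψ(X_n, β(T) - β(t_n))) bounds the weak error by C Σ (δβ_n)² as soon as
this sum is at most 1 (`IsNoisyCoeff.exists_weak_error_le`). The Euler scheme is the case without
noise.

The mean of Σ (δβ_n)² is N (T/N)^(2H), which vanishes since 2H > 1. The constant C depends on the
path through its size on [0, T], and no moment of it is controlled; hence almost sure convergence
along subsequences, then dominated convergence, φ being bounded. -/

theorem gronwallBound_le_mul_exp {δ K ε x : ℝ} (hK : 0 ≤ K) (hε : 0 ≤ ε) :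
    gronwallBound δ K ε x ≤ (δ + ε * x) * Real.exp (K * x) := by
  rcases hK.eq_or_lt with rfl | hK
  · simp [gronwallBound_K0]
  · rw [gronwallBound_of_K_ne_0 hK.ne', add_mul]
    have h : Real.exp (K * x) - 1 ≤ K * x * Real.exp (K * x) := by
      have h1 := Real.add_one_le_exp (-(K * x))
      have h2 : Real.exp (-(K * x)) * Real.exp (K * x) = 1 := by rw [← Real.exp_add]; simp
      nlinarith [Real.exp_pos (K * x)]
    have h3 : ε / K * (Real.exp (K * x) - 1) ≤ ε / K * (K * x * Real.exp (K * x)) := by gcongr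
    have h4 : ε / K * (K * x * Real.exp (K * x)) = ε * x * Real.exp (K * x) := by field_simp
    linarith

/-- Grönwall's inequality for a differential inequality around the origin, in both directions. -/
theorem abs_le_of_abs_deriv_le {f f' : ℝ → ℝ} {K ε t : ℝ} (hK : 0 ≤ K) (hε : 0 ≤ ε)
    (hf : ∀ r, |r| ≤ |t| → HasDerivAt f (f' r) r)
    (hb : ∀ r, |r| ≤ |t| → |f' r| ≤ K * |f r| + ε) :
    |f t| ≤ (|f 0| + ε * |t|) * Real.exp (K * |t|) := by
  have key : ∀ (h h' : ℝ → ℝ) (s : ℝ), 0 ≤ s →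
      (∀ r, |r| ≤ s → HasDerivAt h (h' r) r) → (∀ r, |r| ≤ s → |h' r| ≤ K * |h r| + ε) →
      |h s| ≤ (|h 0| + ε * s) * Real.exp (K * s) := by
    intro h h' s hs hd hbd
    have hr : ∀ r ∈ Set.Icc 0 s, |r| ≤ s := fun r hr => by rw [abs_of_nonneg hr.1]; exact hr.2
    have := norm_le_gronwallBound_of_norm_deriv_right_le (f := h) (f' := h') (δ := |h 0|) (K := K)
      (ε := ε) (a := 0) (b := s)
      (fun r hr' => (hd r (hr r hr')).continuousAt.continuousWithinAt)
      (fun r hr' => (hd r (hr r ⟨hr'.1, hr'.2.le⟩)).hasDerivWithinAt) le_rfl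
      (fun r hr' => hbd r (hr r ⟨hr'.1, hr'.2.le⟩)) s ⟨hs, le_rfl⟩
    rw [sub_zero] at this
    exact this.trans (gronwallBound_le_mul_exp hK hε)
  rcases le_total 0 t with ht | ht
  · rw [abs_of_nonneg ht] at *
    exact key f f' t ht hf hb
  · have h1 := key (fun r => f (-r)) (fun r => -f' (-r)) (-t) (by linarith)
      (fun r hr => by
        have h2 := (hf (-r) (by rwa [abs_neg, abs_of_nonpos ht])).comp r (hasDerivAt_neg r)
        simpa [Function.comp_def] using h2)
      (fun r hr => by
        rw [abs_neg]
        exact hb (-r) (by rwa [abs_neg, abs_of_nonpos ht]))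
    rw [abs_of_nonpos ht]
    simpa using h1

/-- For a globally bounded field the Picard–Lindelöf ball may have radius R T, so T need not be
small. -/
theorem exists_solution_Ioo_of_bounded {v : ℝ → ℝ} {K : ℝ≥0} (hv : LipschitzWith K v) {R : ℝ≥0}
    (hR : ∀ x, |v x| ≤ R) (x : ℝ) {T : ℝ} (hT : 0 < T) :
    ∃ α : ℝ → ℝ, α 0 = x ∧ ∀ t ∈ Set.Ioo (-T) T, HasDerivAt α (v (α t)) t := by
  have hpl : IsPicardLindelof (fun _ => v) (tmin := -T) (tmax := T)
      ⟨0, by simp [hT.le]⟩ x (R * T.toNNReal) 0 R K :=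
    IsPicardLindelof.of_time_independent (fun y _ => hR y) hv.lipschitzOnWith (by simp [hT.le])
  obtain ⟨α, h0, hα⟩ := hpl.exists_eq_forall_mem_Icc_hasDerivWithinAt₀
  exact ⟨α, h0, fun t ht => (hα t (Set.Ioo_subset_Icc_self ht)).hasDerivAt
    (Icc_mem_nhds ht.1 ht.2)⟩

theorem exists_solution_Ioo {v : ℝ → ℝ} {K : ℝ≥0} (hv : LipschitzWith K v) (x : ℝ) {T : ℝ}
    (hT : 0 < T) :
    ∃ α : ℝ → ℝ, α 0 = x ∧ ∀ t ∈ Set.Ioo (-T) T, HasDerivAt α (v (α t)) t := by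
  -- R bounds |v| on the region that the a priori Grönwall estimate allows up to time T. The field
  -- truncated at level R is bounded, and its solution never meets the truncation.
  set R : ℝ := |v 0| + K * ((|x| + |v 0| * T) * Real.exp (K * T)) with hRdef
  have hR0 : 0 ≤ R := by positivity
  have hgrowth : ∀ y, |v y| ≤ K * |y| + |v 0| := fun y => by
    have h1 := hv.dist_le_mul y 0
    rw [Real.dist_eq, Real.dist_eq, sub_zero] at h1
    have h2 := abs_sub_abs_le_abs_sub (v y) (v 0)
    linarith
  set w : ℝ → ℝ := fun y => max (-R) (min R (v y)) with hw
  have hwlip : LipschitzWith K w := (hv.const_min R).const_max (-R)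
  have hwR : ∀ y, |w y| ≤ (⟨R, hR0⟩ : ℝ≥0) := fun y => by
    rw [abs_le]
    exact ⟨le_max_left _ _, max_le (by simp [hR0]) (min_le_left _ _)⟩
  -- Truncation does not increase |v|, so the truncated field inherits a growth bound independent of
  -- R; this avoids circularity.
  have hwv : ∀ y, |w y| ≤ |v y| := fun y => by
    simp only [hw]
    rw [abs_le]
    constructor
    · rcases le_total R (v y) with h | h
      · rw [min_eq_left h]; exact le_max_of_le_right (by linarith [abs_nonneg (v y)])
      · rw [min_eq_right h]; exact le_max_of_le_right (neg_abs_le _)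
    · exact max_le (by linarith [abs_nonneg (v y)]) ((min_le_right _ _).trans (le_abs_self _))
  obtain ⟨α, h0, hα⟩ := exists_solution_Ioo_of_bounded hwlip hwR x hT
  refine ⟨α, h0, fun t ht => ?_⟩
  have ht' : |t| < T := abs_lt.2 ht
  have hbound : |α t| ≤ (|x| + |v 0| * T) * Real.exp (K * T) := by
    have h1 := abs_le_of_abs_deriv_le (f := α) (f' := fun r => w (α r)) (t := t) K.coe_nonneg
      (abs_nonneg (v 0)) (fun r hr => hα r (abs_lt.1 (hr.trans_lt ht')))
      (fun r _ => (hwv _).trans (hgrowth _))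
    rw [h0] at h1
    refine h1.trans ?_
    gcongr
  have hv' : |v (α t)| ≤ R := by
    refine (hgrowth _).trans ?_
    rw [hRdef, add_comm]
    gcongr
  have hwt : w (α t) = v (α t) := by
    have := abs_le.1 hv'
    simp only [hw]
    rw [min_eq_right this.2, max_eq_right this.1]
  exact hwt ▸ hα t ht

theorem exists_global_solution {v : ℝ → ℝ} {K : ℝ≥0} (hv : LipschitzWith K v) (x : ℝ) :
    ∃ α : ℝ → ℝ, α 0 = x ∧ ∀ t, HasDerivAt α (v (α t)) t := by
  have hex : ∀ a : ℝ, ∃ α : ℝ → ℝ, α 0 = x ∧ ∀ t ∈ Set.Ioo (-a) a, HasDerivAt α (v (α t)) t := by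
    intro a
    by_cases ha : 0 < a
    · exact exists_solution_Ioo hv x ha
    · exact ⟨fun _ => x, rfl, fun t ht => absurd (ht.1.trans ht.2) (by linarith)⟩
  choose α h0 hα using hex
  have huniq : ∀ a a' : ℝ, 0 < a → a ≤ a' → Set.EqOn (α a) (α a') (Set.Ioo (-a) a) := by
    intro a a' ha haa
    refine ODE_solution_unique_of_mem_Ioo (v := fun _ => v) (s := fun _ => Set.univ) (t₀ := 0)
      (K := K) (fun _ _ => hv.lipschitzOnWith) ⟨by linarith, ha⟩
      (fun t ht => ⟨hα a t ht, trivial⟩)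
      (fun t ht => ⟨hα a' t ⟨by linarith [ht.1], by linarith [ht.2]⟩, trivial⟩) ?_
    rw [h0, h0]
  -- The margin 1 keeps t interior; near t the glued curve equals one fixed local solution by
  -- uniqueness.
  refine ⟨fun t => α (|t| + 1) t, h0 _, fun t => ?_⟩
  have ht : t ∈ Set.Ioo (-(|t| + 1)) (|t| + 1) := abs_lt.1 (lt_add_one _)
  refine (hα (|t| + 1) t ht).congr_of_eventuallyEq ?_
  filter_upwards [Ioo_mem_nhds ht.1 ht.2] with r hr
  have hr' : r ∈ Set.Ioo (-(|r| + 1)) (|r| + 1) := abs_lt.1 (lt_add_one _)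
  rcases le_total (|r| + 1) (|t| + 1) with h | h
  · exact huniq _ _ (by positivity) h hr'
  · exact (huniq _ _ (by positivity) h hr).symm

/-- `ψ x` is the integral curve of the autonomous vector field `v` starting from `x`. -/
structure IsFlow (v : ℝ → ℝ) (ψ : ℝ → ℝ → ℝ) : Prop where
  zero : ∀ x, ψ x 0 = x
  hasDerivAt : ∀ x t, HasDerivAt (ψ x) (v (ψ x t)) t

theorem exists_isFlow {v : ℝ → ℝ} {K : ℝ≥0} (hv : LipschitzWith K v) : ∃ ψ, IsFlow v ψ := by
  choose ψ h0 hψ using exists_global_solution hv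
  exact ⟨ψ, h0, hψ⟩

/-- `v` is differentiable with derivative `v'`, both being Lipschitz with constant `K`; the
differentiability is recorded by a quadratic Taylor bound. -/
structure IsCOneOne (K : ℝ≥0) (v v' : ℝ → ℝ) : Prop where
  lipschitz : LipschitzWith K v
  lipschitz_deriv : LipschitzWith K v'
  abs_deriv_le : ∀ x, |v' x| ≤ K
  taylor : ∀ x y, |v y - v x - v' x * (y - x)| ≤ K * (y - x) ^ 2

theorem _root_.LipschitzWith.abs_sub_le {K : ℝ≥0} {v : ℝ → ℝ} (hv : LipschitzWith K v) (x y : ℝ) :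
    |v y - v x| ≤ K * |y - x| := by
  simpa [Real.dist_eq] using hv.dist_le_mul y x

namespace IsFlow

variable {v v' : ℝ → ℝ} {ψ : ℝ → ℝ → ℝ} {K : ℝ≥0}

theorem flow_add (hψ : IsFlow v ψ) (hv : LipschitzWith K v) (x s t : ℝ) :
    ψ (ψ x s) t = ψ x (s + t) := by
  have h : ψ (ψ x s) = fun t => ψ x (s + t) := by
    refine ODE_solution_unique_univ (v := fun _ => v) (s := fun _ => Set.univ) (t₀ := 0)
      (K := K) (fun _ => hv.lipschitzOnWith) (fun t => ⟨hψ.hasDerivAt _ t, trivial⟩)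
      (fun t => ⟨?_, trivial⟩) ?_
    · exact (hψ.hasDerivAt x (s + t)).comp_const_add s t
    · simp [hψ.zero]
  exact congrFun h t

theorem abs_sub_le (hψ : IsFlow v ψ) (hv : LipschitzWith K v) (x y s : ℝ) :
    |ψ y s - ψ x s| ≤ |y - x| * Real.exp (K * |s|) := by
  have := abs_le_of_abs_deriv_le (f := fun s => ψ y s - ψ x s) (t := s) K.coe_nonneg le_rfl
    (fun r _ => (hψ.hasDerivAt y r).sub (hψ.hasDerivAt x r))
    (fun r _ => by simpa using hv.abs_sub_le (ψ x r) (ψ y r))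
  simpa [hψ.zero] using this

theorem abs_sub_self_le (hψ : IsFlow v ψ) (hv : LipschitzWith K v) (x s : ℝ) :
    |ψ x s - x| ≤ |v x| * |s| * Real.exp (K * |s|) := by
  have := abs_le_of_abs_deriv_le (f := fun s => ψ x s - x) (t := s) K.coe_nonneg (abs_nonneg (v x))
    (fun r _ => (hψ.hasDerivAt x r).sub_const x)
    (fun r _ => by
      have h1 := hv.abs_sub_le x (ψ x r)
      have h2 := abs_sub_abs_le_abs_sub (v (ψ x r)) (v x)
      linarith)
  simpa [hψ.zero] using this

theorem abs_sub_self_sub_le (hψ : IsFlow v ψ) (hv : LipschitzWith K v) (x s : ℝ) :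
    |ψ x s - x - v x * s| ≤ K * |v x| * s ^ 2 * Real.exp (K * |s|) := by
  have := abs_le_of_abs_deriv_le (f := fun s => ψ x s - x - v x * s)
    (f' := fun s => v (ψ x s) - v x) (ε := K * |v x| * |s|) (t := s) K.coe_nonneg (by positivity)
    (fun r _ => by
      have h := ((hψ.hasDerivAt x r).sub_const x).fun_sub ((hasDerivAt_id r).const_mul (v x))
      rwa [mul_one] at h)
    (fun r hr => by
      have h1 := hv.abs_sub_le x (ψ x r)
      have h2 : |ψ x r - x| ≤ |ψ x r - x - v x * r| + |v x| * |s| := by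
        calc |ψ x r - x| = |(ψ x r - x - v x * r) + v x * r| := by ring_nf
          _ ≤ |ψ x r - x - v x * r| + |v x * r| := abs_add_le _ _
          _ ≤ _ := by rw [abs_mul (v x)]; gcongr
      calc |v (ψ x r) - v x| ≤ K * |ψ x r - x| := h1
        _ ≤ K * (|ψ x r - x - v x * r| + |v x| * |s|) := by gcongr
        _ = _ := by ring)
  have h3 : K * |v x| * |s| * |s| = K * |v x| * s ^ 2 := by rw [mul_assoc, abs_mul_abs_self]; ring
  simpa [hψ.zero, h3] using this

/-- The number d is the derivative of the flow in its starting point: it solves the linearized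
equation, whose solution is an explicit exponential in dimension one. Of the three exponential
factors, two come from the squared Lipschitz bound and one from Grönwall. -/
theorem exists_abs_sub_sub_le (hψ : IsFlow v ψ) (hv : IsCOneOne K v v') (x s : ℝ) :
    ∃ d, ∀ y, |ψ y s - ψ x s - d * (y - x)| ≤
      K * |s| * Real.exp (3 * (K * |s|)) * (y - x) ^ 2 := by
  have hcont : Continuous fun r => v' (ψ x r) := hv.lipschitz_deriv.continuous.comp
    (continuous_iff_continuousAt.2 fun r => (hψ.hasDerivAt x r).continuousAt)
  set D : ℝ → ℝ := fun r => Real.exp (∫ u in (0 : ℝ)..r, v' (ψ x u)) with hD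
  have hD' : ∀ r, HasDerivAt D (v' (ψ x r) * D r) r := fun r => by
    have := (intervalIntegral.integral_hasDerivAt_right (hcont.intervalIntegrable 0 r)
      (hcont.stronglyMeasurableAtFilter _ _) hcont.continuousAt).exp
    rwa [mul_comm] at this
  have hD0 : D 0 = 1 := by simp [hD]
  refine ⟨D s, fun y => ?_⟩
  have := abs_le_of_abs_deriv_le (f := fun s => ψ y s - ψ x s - D s * (y - x))
    (ε := K * (|y - x| * Real.exp (K * |s|)) ^ 2) (t := s) K.coe_nonneg (by positivity)
    (fun r _ => ((hψ.hasDerivAt y r).sub (hψ.hasDerivAt x r)).sub ((hD' r).mul_const (y - x)))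
    (fun r hr => by
      have h1 := hv.taylor (ψ x r) (ψ y r)
      have h2 : |ψ y r - ψ x r| ≤ |y - x| * Real.exp (K * |s|) :=
        (hψ.abs_sub_le hv.lipschitz x y r).trans (by gcongr)
      have h3 : (ψ y r - ψ x r) ^ 2 ≤ (|y - x| * Real.exp (K * |s|)) ^ 2 := by
        rw [← sq_abs (ψ y r - ψ x r)]; gcongr
      calc |v (ψ y r) - v (ψ x r) - v' (ψ x r) * D r * (y - x)|
          = |v' (ψ x r) * (ψ y r - ψ x r - D r * (y - x)) +
            (v (ψ y r) - v (ψ x r) - v' (ψ x r) * (ψ y r - ψ x r))| := by ring_nf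
        _ ≤ |v' (ψ x r) * (ψ y r - ψ x r - D r * (y - x))| +
            |v (ψ y r) - v (ψ x r) - v' (ψ x r) * (ψ y r - ψ x r)| := abs_add_le _ _
        _ ≤ K * |ψ y r - ψ x r - D r * (y - x)| + K * (|y - x| * Real.exp (K * |s|)) ^ 2 := by
          rw [abs_mul]
          exact add_le_add (by gcongr; exact hv.abs_deriv_le _) (h1.trans (by gcongr)))
  refine this.trans (le_of_eq ?_)
  have h4 : Real.exp (3 * (K * |s|)) = Real.exp (K * |s|) ^ 3 := by
    rw [← Real.exp_nat_mul]; norm_num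
  simp only [hψ.zero, hD0, one_mul, sub_self, abs_zero, zero_add, mul_pow, sq_abs, h4]
  ring

end IsFlow

/-! ### Regularity of the averaged coefficient -/

theorem abs_taylor_le_of_lipschitz_deriv {h h' : ℝ → ℝ} {K : ℝ≥0}
    (hd : ∀ x, HasDerivAt h (h' x) x) (hl : LipschitzWith K h') (x y : ℝ) :
    |h y - h x - h' x * (y - x)| ≤ K * (y - x) ^ 2 := by
  have hder : ∀ z, HasDerivAt (fun z => h z - h' x * z) (h' z - h' x) z := fun z => by
    have := (hd z).fun_sub ((hasDerivAt_id z).const_mul (h' x))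
    rwa [mul_one] at this
  have := (convex_uIcc x y).norm_image_sub_le_of_norm_hasDerivWithin_le (C := K * |y - x|)
    (fun z _ => (hder z).hasDerivWithinAt) (fun z hz => ?_) Set.left_mem_uIcc Set.right_mem_uIcc
  · rw [Real.norm_eq_abs, Real.norm_eq_abs, mul_assoc, abs_mul_abs_self] at this
    calc |h y - h x - h' x * (y - x)| = |h y - h' x * y - (h x - h' x * x)| := by ring_nf
      _ ≤ K * ((y - x) * (y - x)) := this
      _ = _ := by ring
  · refine (hl.abs_sub_le x z).trans ?_
    gcongr 1
    exact Set.abs_sub_left_of_mem_uIcc hz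

theorem isCOneOne_of_hasDerivAt {h h' : ℝ → ℝ} {K : ℝ≥0} (hd : ∀ x, HasDerivAt h (h' x) x)
    (hb : ∀ x, |h' x| ≤ K) (hl : LipschitzWith K h') : IsCOneOne K h h' where
  lipschitz := lipschitzWith_of_nnnorm_deriv_le (fun x => (hd x).differentiableAt)
    (fun x => by rw [(hd x).deriv]; exact hb x)
  lipschitz_deriv := hl
  abs_deriv_le := hb
  taylor := abs_taylor_le_of_lipschitz_deriv hd hl

theorem IsCb.exists_isCOneOne {φ : ℝ → ℝ} (hφ : IsCb 3 φ) : ∃ K, IsCOneOne K φ (deriv φ) := by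
  obtain ⟨hc, hb⟩ := hφ
  obtain ⟨C₁, h₁⟩ := hb 1 (by norm_num)
  obtain ⟨C₂, h₂⟩ := hb 2 (by norm_num)
  refine ⟨(max C₁ C₂).toNNReal, isCOneOne_of_hasDerivAt
    (fun x => (hc.differentiable (by norm_num) x).hasDerivAt) (fun x => ?_) ?_⟩
  · have := h₁ x
    rw [iteratedDeriv_one] at this
    exact (this.trans (le_max_left _ _)).trans (Real.le_coe_toNNReal _)
  · refine lipschitzWith_of_nnnorm_deriv_le ?_ (fun x => ?_)
    · exact ((contDiff_succ_iff_deriv (n := 2)).1 hc).2.2.differentiable (by norm_num)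
    · have := h₂ x
      rw [iteratedDeriv_succ, iteratedDeriv_one] at this
      exact (this.trans (le_max_right _ _)).trans (Real.le_coe_toNNReal _)

/-- The partial derivative with respect to the first variable of a function on the plane. -/
def derivFst (g : ℝ × ℝ → ℝ) (z : ℝ × ℝ) : ℝ := fderiv ℝ g z (1, 0)

theorem IsAdmissibleCoeff.exists_lipschitz {g : ℝ × ℝ → ℝ} (hg : IsAdmissibleCoeff g) :
    ∃ K : ℝ≥0, LipschitzWith K g ∧ ∀ m, IsCOneOne K (fun x => g (x, m))
      (fun x => derivFst g (x, m)) := by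
  obtain ⟨hc, hb⟩ := hg
  obtain ⟨C₁, h₁⟩ := hb 1 (by norm_num) (by norm_num)
  obtain ⟨C₂, h₂⟩ := hb 2 (by norm_num) (by norm_num)
  have hfd : ∀ z, ‖fderiv ℝ g z‖ ≤ ((max C₁ C₂).toNNReal : ℝ) := fun z => by
    have := h₁ z
    rw [norm_iteratedFDeriv_one] at this
    exact (this.trans (le_max_left _ _)).trans (Real.le_coe_toNNReal _)
  have hfd2 : ∀ z, ‖fderiv ℝ (fderiv ℝ g) z‖ ≤ ((max C₁ C₂).toNNReal : ℝ) := fun z => by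
    have := h₂ z
    rw [← norm_iteratedFDeriv_fderiv, norm_iteratedFDeriv_one] at this
    exact (this.trans (le_max_right _ _)).trans (Real.le_coe_toNNReal _)
  have hdiff : Differentiable ℝ g := hc.differentiable (by norm_num)
  have hdiff2 : Differentiable ℝ (fderiv ℝ g) :=
    ((contDiff_succ_iff_fderiv (n := 2)).1 hc).2.2.differentiable (by norm_num)
  have hl2 : LipschitzWith (max C₁ C₂).toNNReal (fderiv ℝ g) :=
    lipschitzWith_of_nnnorm_fderiv_le hdiff2 hfd2
  have hn : ‖((1 : ℝ), (0 : ℝ))‖ = 1 := by simp [Prod.norm_def]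
  refine ⟨(max C₁ C₂).toNNReal, lipschitzWith_of_nnnorm_fderiv_le hdiff hfd, fun m =>
    isCOneOne_of_hasDerivAt (fun x => ?_) (fun x => ?_) (LipschitzWith.of_dist_le_mul fun x y => ?_)⟩
  · have h1 : HasDerivAt (fun x : ℝ => (x, m)) (1, 0) x :=
      (hasDerivAt_id x).prodMk (hasDerivAt_const x m)
    exact (hdiff (x, m)).hasFDerivAt.comp_hasDerivAt x h1
  · have := (fderiv ℝ g (x, m)).le_opNorm (1, 0)
    rw [hn, mul_one] at this
    exact this.trans (hfd _)
  · have h1 := (fderiv ℝ g (x, m) - fderiv ℝ g (y, m)).le_opNorm (1, 0)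
    have h2 := hl2.dist_le_mul (x, m) (y, m)
    rw [dist_eq_norm, Prod.dist_eq, dist_self, max_eq_left dist_nonneg] at h2
    rw [hn, mul_one] at h1
    exact h1.trans h2

theorem abs_le_of_lipschitz {g : ℝ × ℝ → ℝ} {K : ℝ≥0} (hg : LipschitzWith K g) (x m : ℝ) :
    |g (x, m)| ≤ (K + |g (0, 0)|) * (1 + |x| + |m|) := by
  have h1 := hg.dist_le_mul (x, m) (0, 0)
  rw [Real.dist_eq, Prod.dist_eq, Real.dist_0_eq_abs, Real.dist_0_eq_abs] at h1
  have h2 := abs_sub_abs_le_abs_sub (g (x, m)) (g (0, 0))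
  have h3 : max |x| |m| ≤ |x| + |m| := max_le (by linarith [abs_nonneg m]) (by linarith [abs_nonneg x])
  have h4 := mul_le_mul_of_nonneg_left h3 K.coe_nonneg
  nlinarith [abs_nonneg x, abs_nonneg m, abs_nonneg (g (0, 0)), K.coe_nonneg,
    mul_nonneg (abs_nonneg (g (0,0))) (abs_nonneg x), mul_nonneg (abs_nonneg (g (0,0))) (abs_nonneg m)]

theorem memLp_id_gaussian : MemLp (fun m : ℝ => m) 2 (gaussianReal 0 1) :=
  memLp_id_gaussianReal 2

theorem integrable_of_linear_growth {G : ℝ × ℝ → ℝ} (hG : Measurable G) {A : ℝ}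
    (hA : ∀ x m, |G (x, m)| ≤ A * (1 + |x| + |m|)) (x : ℝ) :
    Integrable (fun m => G (x, m)) (gaussianReal 0 1) := by
  have hm : Integrable (fun m : ℝ => A * (1 + |x| + |m|)) (gaussianReal 0 1) :=
    ((integrable_const _).add (memLp_id_gaussian.integrable (by norm_num)).abs).const_mul A
  exact hm.mono' (hG.comp measurable_prodMk_left).aestronglyMeasurable (ae_of_all _ fun m => hA x m)

/-- Each bound in `IsCOneOne` is uniform in m and so survives integration; no differentiation under
the integral is needed. -/
theorem IsAdmissibleCoeff.exists_isCOneOne_averagedCoeff {g : ℝ × ℝ → ℝ}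
    (hg : IsAdmissibleCoeff g) : ∃ K v', IsCOneOne K (averagedCoeff g) v' := by
  obtain ⟨K, hK, hC⟩ := hg.exists_lipschitz
  have hint : ∀ x, Integrable (fun m => g (x, m)) (gaussianReal 0 1) :=
    integrable_of_linear_growth hK.continuous.measurable (abs_le_of_lipschitz hK)
  have hmeas : Measurable (derivFst g) := measurable_fderiv_apply_const ℝ g (1, 0)
  have hint' : ∀ x, Integrable (fun m => derivFst g (x, m)) (gaussianReal 0 1) := fun x =>
    Integrable.of_bound (hmeas.comp measurable_prodMk_left).aestronglyMeasurable (K : ℝ)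
      (ae_of_all _ fun m => (hC m).abs_deriv_le x)
  have hbound : ∀ {f : ℝ → ℝ} {c : ℝ}, (∀ m, |f m| ≤ c) → |∫ m, f m ∂gaussianReal 0 1| ≤ c := by
    intro f c hf
    simpa using norm_integral_le_of_norm_le_const (μ := gaussianReal 0 1) (f := f) (C := c)
      (ae_of_all _ hf)
  refine ⟨K, fun x => ∫ m, derivFst g (x, m) ∂gaussianReal 0 1, ?_, ?_, ?_, ?_⟩
  · refine LipschitzWith.of_dist_le_mul fun x y => ?_
    rw [Real.dist_eq, averagedCoeff, averagedCoeff, ← integral_sub (hint x) (hint y)]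
    exact hbound fun m => (hC m).lipschitz.dist_le_mul x y
  · refine LipschitzWith.of_dist_le_mul fun x y => ?_
    rw [Real.dist_eq, ← integral_sub (hint' x) (hint' y)]
    exact hbound fun m => (hC m).lipschitz_deriv.dist_le_mul x y
  · exact fun x => hbound fun m => (hC m).abs_deriv_le x
  · intro x y
    rw [averagedCoeff, averagedCoeff, ← integral_sub (hint y) (hint x), ← integral_mul_const,
      ← integral_sub ((hint y).sub' (hint x)) ((hint' x).mul_const _)]
    exact hbound fun m => (hC m).taylor x y

/-! ### Test functions transported by the flow -/

/-- Lipschitz functions with a first-order Taylor expansion up to a quadratic remainder, uniformly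
in the base point. -/
structure IsTestFun (L : ℝ≥0) (f : ℝ → ℝ) : Prop where
  lipschitz : LipschitzWith L f
  taylor : ∀ x, ∃ d, ∀ y, |f y - f x - d * (y - x)| ≤ L * (y - x) ^ 2

/-- One constant serves all |s| ≤ S, so the one-step error constants do not depend on the step index
or on N. -/
theorem IsCOneOne.exists_isTestFun_comp_flow {v v' : ℝ → ℝ} {ψ : ℝ → ℝ → ℝ} {K : ℝ≥0}
    (hv : IsCOneOne K v v') (hψ : IsFlow v ψ) {h h' : ℝ → ℝ} {L : ℝ≥0} (hh : IsCOneOne L h h')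
    (S : ℝ≥0) : ∃ L' : ℝ≥0, ∀ s : ℝ, |s| ≤ S → IsTestFun L' (fun x => h (ψ x s)) := by
  obtain ⟨E, hE⟩ : ∃ E : ℝ≥0, (E : ℝ) = Real.exp (K * S) := ⟨⟨_, (Real.exp_pos _).le⟩, rfl⟩
  -- The terms come from the Taylor remainder of h, that of the flow, and the Lipschitz bound.
  refine ⟨L * E ^ 2 + L * (K * S * E ^ 3) + L * E, fun s hs => ⟨?_, fun x => ?_⟩⟩
  · refine LipschitzWith.of_dist_le_mul fun x y => ?_
    rw [Real.dist_eq, Real.dist_eq]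
    calc |h (ψ x s) - h (ψ y s)| ≤ L * |ψ x s - ψ y s| := hh.lipschitz.abs_sub_le _ _
      _ ≤ L * (|x - y| * Real.exp (K * |s|)) := by
        gcongr; exact hψ.abs_sub_le hv.lipschitz y x s
      _ ≤ L * (|x - y| * E) := by rw [hE]; gcongr
      _ = (L * E) * |x - y| := by ring
      _ ≤ _ := by
        gcongr
        push_cast
        have : 0 ≤ (L : ℝ) * E ^ 2 + L * (K * S * E ^ 3) := by positivity
        linarith
  · obtain ⟨d, hd⟩ := hψ.exists_abs_sub_sub_le hv x s
    refine ⟨h' (ψ x s) * d, fun y => ?_⟩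
    have h1 : |h (ψ y s) - h (ψ x s) - h' (ψ x s) * (ψ y s - ψ x s)| ≤ L * E ^ 2 * (y - x) ^ 2 := by
      refine (hh.taylor _ _).trans ?_
      have : |ψ y s - ψ x s| ≤ |y - x| * E :=
        (hψ.abs_sub_le hv.lipschitz x y s).trans (by rw [hE]; gcongr)
      calc (L : ℝ) * (ψ y s - ψ x s) ^ 2 = L * |ψ y s - ψ x s| ^ 2 := by rw [sq_abs]
        _ ≤ L * (|y - x| * E) ^ 2 := by gcongr
        _ = L * E ^ 2 * |y - x| ^ 2 := by ring
        _ = _ := by rw [sq_abs]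
    have h2 : |h' (ψ x s) * (ψ y s - ψ x s - d * (y - x))| ≤
        L * (K * S * E ^ 3) * (y - x) ^ 2 := by
      have h3 : Real.exp (3 * (K * |s|)) ≤ (E : ℝ) ^ 3 := by
        rw [hE, ← Real.exp_nat_mul]
        push_cast
        gcongr
      rw [abs_mul, mul_assoc]
      refine mul_le_mul (hh.abs_deriv_le _) ((hd y).trans ?_) (abs_nonneg _) L.coe_nonneg
      gcongr
    push_cast
    calc |h (ψ y s) - h (ψ x s) - h' (ψ x s) * d * (y - x)|
        = |(h (ψ y s) - h (ψ x s) - h' (ψ x s) * (ψ y s - ψ x s)) +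
          h' (ψ x s) * (ψ y s - ψ x s - d * (y - x))| := by ring_nf
      _ ≤ _ := abs_add_le _ _
      _ ≤ L * E ^ 2 * (y - x) ^ 2 + L * (K * S * E ^ 3) * (y - x) ^ 2 := add_le_add h1 h2
      _ ≤ _ := by
        rw [← add_mul]
        refine mul_le_mul_of_nonneg_right ?_ (sq_nonneg _)
        linarith [mul_nonneg L.coe_nonneg E.coe_nonneg]

theorem IsFlow.exists_abs_le {v : ℝ → ℝ} {ψ : ℝ → ℝ → ℝ} {K : ℝ≥0} (hψ : IsFlow v ψ)
    (hv : LipschitzWith K v) (S : ℝ≥0) :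
    ∃ C : ℝ≥0, ∀ s : ℝ, |s| ≤ S → ∀ x, 1 + |x| ≤ C * (1 + |ψ x s|) := by
  obtain ⟨E, hE⟩ : ∃ E : ℝ≥0, (E : ℝ) = Real.exp (K * S) := ⟨⟨_, (Real.exp_pos _).le⟩, rfl⟩
  obtain ⟨V, hV⟩ : ∃ V : ℝ≥0, (V : ℝ) = |v 0| := ⟨⟨_, abs_nonneg _⟩, rfl⟩
  refine ⟨1 + (K + V) * S * E, fun s hs x => ?_⟩
  -- The flow is run backwards from ψ x s, which returns to x.
  have h1 := hψ.abs_sub_self_le hv (ψ x s) (-s)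
  rw [hψ.flow_add hv, add_neg_cancel, hψ.zero, abs_neg] at h1
  have h2 := hv.abs_sub_le 0 (ψ x s)
  have h3 := abs_sub_abs_le_abs_sub (v (ψ x s)) (v 0)
  have h4 := abs_sub_abs_le_abs_sub x (ψ x s)
  rw [sub_zero] at h2
  have h5 : |v (ψ x s)| ≤ (K + V) * (1 + |ψ x s|) := by
    nlinarith [K.coe_nonneg, V.coe_nonneg, abs_nonneg (ψ x s),
      mul_nonneg V.coe_nonneg (abs_nonneg (ψ x s))]
  have h6 : |v (ψ x s)| * |s| * Real.exp (K * |s|) ≤ (K + V) * (1 + |ψ x s|) * S * E := by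
    rw [hE]; gcongr
  push_cast
  linarith

/-- A smooth substitute for 1 + |x|, regular enough to serve as a test function in the moment bound.
-/
theorem isCOneOne_sqrt_one_add_sq :
    IsCOneOne 1 (fun x => √(1 + x ^ 2)) (fun x => x / √(1 + x ^ 2)) := by
  have hpos : ∀ x : ℝ, 0 < 1 + x ^ 2 := fun x => by positivity
  have hs : ∀ x : ℝ, 0 < √(1 + x ^ 2) := fun x => Real.sqrt_pos.2 (hpos x)
  have hd : ∀ x : ℝ, HasDerivAt (fun x => √(1 + x ^ 2)) (x / √(1 + x ^ 2)) x := fun x => by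
    have h1 : HasDerivAt (fun x : ℝ => 1 + x ^ 2) (2 * x) x := by
      simpa using (hasDerivAt_pow 2 x).const_add 1
    convert h1.sqrt (hpos x).ne' using 1
    rw [mul_div_mul_left _ _ two_ne_zero]
  refine isCOneOne_of_hasDerivAt hd (fun x => ?_) ?_
  · rw [abs_div, abs_of_pos (hs x), NNReal.coe_one, div_le_one (hs x)]
    exact Real.abs_le_sqrt (by linarith)
  · have hd2 : ∀ x : ℝ, HasDerivAt (fun x => x / √(1 + x ^ 2))
        ((1 * √(1 + x ^ 2) - x * (x / √(1 + x ^ 2))) / √(1 + x ^ 2) ^ 2) x :=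
      fun x => (hasDerivAt_id x).div (hd x) (hs x).ne'
    refine lipschitzWith_of_nnnorm_deriv_le (fun x => (hd2 x).differentiableAt) (fun x => ?_)
    rw [(hd2 x).deriv, ← NNReal.coe_le_coe, coe_nnnorm, Real.norm_eq_abs, NNReal.coe_one]
    have hsq : √(1 + x ^ 2) ^ 2 = 1 + x ^ 2 := Real.sq_sqrt (hpos x).le
    have h1 : 1 ≤ √(1 + x ^ 2) := Real.one_le_sqrt.2 (by nlinarith)
    have h2 : (1 * √(1 + x ^ 2) - x * (x / √(1 + x ^ 2))) = 1 / √(1 + x ^ 2) := by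
      field_simp
      linarith
    rw [h2, abs_of_nonneg (by positivity), div_div]
    refine div_le_one_of_le₀ ?_ (by positivity)
    nlinarith

/-! ### One step of the scheme -/

/-- `v` is the Gaussian average of `G` in its second variable, and `G` deviates from `v` at most
linearly in the noise, uniformly in the first variable. -/
structure IsNoisyCoeff (G : ℝ × ℝ → ℝ) (v : ℝ → ℝ) (A : ℝ) : Prop where
  measurable : Measurable G
  abs_sub_le : ∀ x m, |G (x, m) - v x| ≤ A * (1 + |m|)
  integral_eq : ∀ x, ∫ m, G (x, m) ∂(gaussianReal 0 1) = v x

theorem memLp_one_add_abs : MemLp (fun m : ℝ => 1 + |m|) 2 (gaussianReal 0 1) :=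
  (memLp_const (1 : ℝ)).add memLp_id_gaussian.abs

theorem IsNoisyCoeff.integrable {G : ℝ × ℝ → ℝ} {v : ℝ → ℝ} {A : ℝ} (hG : IsNoisyCoeff G v A)
    (x : ℝ) : Integrable (fun m => G (x, m)) (gaussianReal 0 1) := by
  have h1 : Integrable (fun m => G (x, m) - v x) (gaussianReal 0 1) :=
    ((memLp_one_add_abs.integrable (by norm_num)).const_mul A).mono'
      ((hG.measurable.comp measurable_prodMk_left).sub_const _).aestronglyMeasurable
      (ae_of_all _ fun m => hG.abs_sub_le x m)
  exact (h1.add (integrable_const (v x))).congr (ae_of_all _ fun m => by simp)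

theorem _root_.LipschitzWith.integrable_comp {Ω : Type*} [MeasurableSpace Ω] {μ : Measure Ω}
    [IsFiniteMeasure μ] {L : ℝ≥0} {f : ℝ → ℝ} (hf : LipschitzWith L f) {X : Ω → ℝ}
    (hX : Integrable X μ) : Integrable (fun ω => f (X ω)) μ := by
  refine ((integrable_const |f 0|).add (hX.abs.const_mul (L : ℝ))).mono'
    (hf.continuous.comp_aestronglyMeasurable hX.aestronglyMeasurable) (ae_of_all _ fun ω => ?_)
  have h1 := hf.abs_sub_le 0 (X ω)
  have h2 := abs_sub_abs_le_abs_sub (f (X ω)) (f 0)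
  rw [sub_zero] at h1
  simp only [Pi.add_apply, Real.norm_eq_abs]
  linarith

theorem IsNoisyCoeff.exists_abs_integral_sub_le {G : ℝ × ℝ → ℝ} {v : ℝ → ℝ} {A : ℝ}
    (hG : IsNoisyCoeff G v A) {K : ℝ≥0} (hv : LipschitzWith K v) {ψ : ℝ → ℝ → ℝ}
    (hψ : IsFlow v ψ) (L S : ℝ≥0) :
    ∃ C : ℝ≥0, ∀ f, IsTestFun L f → ∀ x b : ℝ, |b| ≤ S →
      |∫ m, f (x + G (x, m) * b) ∂(gaussianReal 0 1) - f (ψ x b)| ≤ C * b ^ 2 * (1 + |x|) := by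
  obtain ⟨E, hE⟩ : ∃ E : ℝ≥0, (E : ℝ) = Real.exp (K * S) := ⟨⟨_, (Real.exp_pos _).le⟩, rfl⟩
  obtain ⟨V, hV⟩ : ∃ V : ℝ≥0, (V : ℝ) = |v 0| := ⟨⟨_, abs_nonneg _⟩, rfl⟩
  obtain ⟨c, hc⟩ : ∃ c : ℝ≥0, (c : ℝ) = A ^ 2 * ∫ m, (1 + |m|) ^ 2 ∂(gaussianReal 0 1) :=
    ⟨⟨_, mul_nonneg (sq_nonneg A) (integral_nonneg fun m => by positivity)⟩, rfl⟩
  refine ⟨L * (K * (K + V) * E) + L * c, fun f hf x b hb => ?_⟩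
  set z := ψ x b with hz
  obtain ⟨d, hd⟩ := hf.taylor z
  have hvx : |v x| ≤ (K + V) * (1 + |x|) := by
    have h2 := hv.abs_sub_le 0 x
    have h3 := abs_sub_abs_le_abs_sub (v x) (v 0)
    rw [sub_zero] at h2
    nlinarith [K.coe_nonneg, V.coe_nonneg, abs_nonneg x, mul_nonneg V.coe_nonneg (abs_nonneg x)]
  have hdrift : |x + v x * b - z| ≤ K * (K + V) * E * b ^ 2 * (1 + |x|) := by
    have h1 := hψ.abs_sub_self_sub_le hv x b
    calc |x + v x * b - z| = |ψ x b - x - v x * b| := by rw [← abs_neg, hz]; ring_nf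
      _ ≤ K * |v x| * b ^ 2 * Real.exp (K * |b|) := h1
      _ ≤ K * ((K + V) * (1 + |x|)) * b ^ 2 * E := by rw [hE]; gcongr
      _ = _ := by ring
  -- Expanding about z = ψ x b leaves the drift defect x + v(x) b - z, of order b², and a remainder
  -- quadratic in the noise. The subtracted linear term is centered.
  have hpt : ∀ m, |f (x + G (x, m) * b) - f z - d * ((G (x, m) - v x) * b)| ≤
      L * (K * (K + V) * E * b ^ 2 * (1 + |x|)) + L * (A ^ 2 * (1 + |m|) ^ 2 * b ^ 2) := by
    intro m
    have h1 : |f (x + G (x, m) * b) - f (z + (G (x, m) - v x) * b)| ≤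
        L * (K * (K + V) * E * b ^ 2 * (1 + |x|)) := by
      refine (hf.lipschitz.abs_sub_le _ _).trans ?_
      gcongr
      refine le_of_eq_of_le ?_ hdrift
      ring_nf
    have h2 : |f (z + (G (x, m) - v x) * b) - f z - d * ((G (x, m) - v x) * b)| ≤
        L * (A ^ 2 * (1 + |m|) ^ 2 * b ^ 2) := by
      have h3 := hd (z + (G (x, m) - v x) * b)
      rw [add_sub_cancel_left] at h3
      refine h3.trans ?_
      rw [mul_pow, ← sq_abs (G (x, m) - v x), ← mul_pow A]
      gcongr
      exact hG.abs_sub_le x m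
    calc _ = |(f (x + G (x, m) * b) - f (z + (G (x, m) - v x) * b)) +
          (f (z + (G (x, m) - v x) * b) - f z - d * ((G (x, m) - v x) * b))| := by ring_nf
      _ ≤ _ := abs_add_le _ _
      _ ≤ _ := add_le_add h1 h2
  have hi1 : Integrable (fun m => f (x + G (x, m) * b)) (gaussianReal 0 1) :=
    LipschitzWith.integrable_comp hf.lipschitz
      ((integrable_const x).add ((hG.integrable x).mul_const b))
  have hi2 : Integrable (fun m => d * ((G (x, m) - v x) * b)) (gaussianReal 0 1) :=
    (((hG.integrable x).sub (integrable_const (v x))).mul_const b).const_mul d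
  have hzero : ∫ m, d * ((G (x, m) - v x) * b) ∂(gaussianReal 0 1) = 0 := by
    rw [integral_const_mul, integral_mul_const,
      integral_sub (hG.integrable x) (integrable_const (v x)), hG.integral_eq]
    simp
  have hsum : ∫ m, (f (x + G (x, m) * b) - f z - d * ((G (x, m) - v x) * b)) ∂(gaussianReal 0 1) =
      ∫ m, f (x + G (x, m) * b) ∂(gaussianReal 0 1) - f z := by
    rw [integral_sub (hi1.sub' (integrable_const _)) hi2, hzero, sub_zero,
      integral_sub hi1 (integrable_const _)]
    simp
  rw [← hsum]
  have hsq : Integrable (fun m : ℝ => (1 + |m|) ^ 2) (gaussianReal 0 1) :=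
    memLp_one_add_abs.integrable_sq
  have hi3 : Integrable (fun m : ℝ => (L : ℝ) * (A ^ 2 * (1 + |m|) ^ 2 * b ^ 2))
      (gaussianReal 0 1) := ((hsq.const_mul _).mul_const _).const_mul _
  rw [← Real.norm_eq_abs]
  refine le_trans (norm_integral_le_of_norm_le (g := fun m =>
    (L : ℝ) * (K * (K + V) * E * b ^ 2 * (1 + |x|)) + L * (A ^ 2 * (1 + |m|) ^ 2 * b ^ 2))
    ((integrable_const _).add hi3) (ae_of_all _ hpt)) ?_
  have hi4 : ∫ m, (L : ℝ) * (A ^ 2 * (1 + |m|) ^ 2 * b ^ 2) ∂(gaussianReal 0 1) =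
      L * (c * b ^ 2) := by
    rw [integral_const_mul, integral_mul_const, integral_const_mul, hc]
  rw [integral_add (integrable_const _) hi3, hi4]
  simp only [integral_const, probReal_univ, smul_eq_mul, one_mul]
  push_cast
  have : 0 ≤ (L : ℝ) * c * b ^ 2 * |x| := by positivity
  nlinarith

/-! ### The scheme driven by a deterministic path -/

/-- The recursion `x_{n+1} = x_n + G (x_n, m_n) b_n` with increments `b` and noise `m`. -/
def scheme (G : ℝ × ℝ → ℝ) (x₀ : ℝ) (b m : ℕ → ℝ) : ℕ → ℝ
  | 0 => x₀
  | n + 1 => scheme G x₀ b m n + G (scheme G x₀ b m n, m n) * b n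

theorem measurable_scheme {α : Type*} {mα : MeasurableSpace α} {G : ℝ × ℝ → ℝ} (hG : Measurable G)
    (x₀ : ℝ) {b m : ℕ → α → ℝ} {n : ℕ} (hb : ∀ k < n, Measurable (b k))
    (hm : ∀ k < n, Measurable (m k)) :
    Measurable fun a => scheme G x₀ (fun k => b k a) (fun k => m k a) n := by
  induction n with
  | zero => exact measurable_const
  | succ n ih =>
    have h := ih (fun k hk => hb k (hk.trans n.lt_succ_self))
      fun k hk => hm k (hk.trans n.lt_succ_self)
    exact h.add ((hG.comp (h.prodMk (hm n n.lt_succ_self))).mul (hb n n.lt_succ_self))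

section Noise

variable {Ω : Type*} [MeasurableSpace Ω] {P : Measure Ω}
  {G : ℝ × ℝ → ℝ} {v : ℝ → ℝ} {A : ℝ} {K : ℝ≥0}

/-- The n-th iterate uses only the noises of index below n. -/
theorem indepFun_scheme {γ : ℕ → Ω → ℝ} (hγ : ∀ n, Measurable (γ n)) (hi : iIndepFun γ P)
    (hG : Measurable G) (x₀ : ℝ) (b : ℕ → ℝ) (n : ℕ) :
    IndepFun (fun ω => scheme G x₀ b (fun k => γ k ω) n) (γ n) P := by
  have h := indep_iSup_of_disjoint (fun k => (hγ k).comap_le) hi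
    (S := Set.Iio n) (T := {n}) (by simp)
  rw [IndepFun_iff_Indep]
  refine indep_of_indep_of_le_left (indep_of_indep_of_le_right h ?_) ?_
  · exact le_iSup₂_of_le (f := fun i (_ : i ∈ ({n} : Set ℕ)) => MeasurableSpace.comap (γ i) _)
      n rfl le_rfl
  · refine Measurable.comap_le ?_
    refine measurable_scheme (mα := ⨆ i ∈ Set.Iio n, MeasurableSpace.comap (γ i) inferInstance)
      (b := fun k _ => b k) hG x₀ (fun _ _ => measurable_const) fun k hk => ?_
    exact Measurable.of_comap_le
      (le_iSup₂_of_le (f := fun i (_ : i ∈ Set.Iio n) => MeasurableSpace.comap (γ i) _) k hk le_rfl)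

variable [IsProbabilityMeasure P]

theorem IsNoisyCoeff.integrable_comp (hG : IsNoisyCoeff G v A) (hv : LipschitzWith K v)
    {X γ : Ω → ℝ} (hX : Measurable X) (hXi : Integrable X P) (hγ : Measurable γ)
    (hlaw : P.map γ = gaussianReal 0 1) : Integrable (fun ω => G (X ω, γ ω)) P := by
  have h1 : Integrable (fun ω => 1 + |γ ω|) P := by
    have := memLp_one_add_abs.integrable (by norm_num)
    rw [← hlaw] at this
    exact this.comp_measurable hγ
  refine ((LipschitzWith.integrable_comp hv hXi).abs.add (h1.const_mul A)).mono'
    (hG.measurable.comp (hX.prodMk hγ)).aestronglyMeasurable (ae_of_all _ fun ω => ?_)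
  have h2 := hG.abs_sub_le (X ω) (γ ω)
  have h3 := abs_sub_abs_le_abs_sub (G (X ω, γ ω)) (v (X ω))
  simp only [Pi.add_apply, Real.norm_eq_abs]
  linarith

/-- By independence the joint law is a product, so the one-step bound can be integrated over the law
of X. -/
theorem IsNoisyCoeff.abs_integral_step_sub_le (hG : IsNoisyCoeff G v A) (hv : LipschitzWith K v)
    {ψ : ℝ → ℝ → ℝ} (hψ : IsFlow v ψ) {f : ℝ → ℝ} {L : ℝ≥0} (hf : LipschitzWith L f) {b C : ℝ}
    (hC : ∀ x, |∫ m, f (x + G (x, m) * b) ∂(gaussianReal 0 1) - f (ψ x b)| ≤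
      C * b ^ 2 * (1 + |x|))
    {X γ : Ω → ℝ} (hX : Measurable X) (hXi : Integrable X P) (hγ : Measurable γ)
    (hlaw : P.map γ = gaussianReal 0 1) (hind : IndepFun X γ P) :
    |∫ ω, f (X ω + G (X ω, γ ω) * b) ∂P - ∫ ω, f (ψ (X ω) b) ∂P| ≤
      C * b ^ 2 * ∫ ω, (1 + |X ω|) ∂P := by
  set F : ℝ × ℝ → ℝ := fun p => f (p.1 + G p * b) with hF
  have hFm : Measurable F := hf.continuous.measurable.comp
    (measurable_fst.add (hG.measurable.mul_const b))
  have hmap : P.map (fun ω => (X ω, γ ω)) = (P.map X).prod (gaussianReal 0 1) := by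
    rw [← hlaw]
    exact (indepFun_iff_map_prod_eq_prod_map_map hX.aemeasurable hγ.aemeasurable).1 hind
  have hFi : Integrable (fun ω => F (X ω, γ ω)) P :=
    LipschitzWith.integrable_comp hf (hXi.add ((hG.integrable_comp hv hX hXi hγ hlaw).mul_const b))
  have hFi' : Integrable F ((P.map X).prod (gaussianReal 0 1)) := by
    rw [← hmap, integrable_map_measure hFm.aestronglyMeasurable (hX.prodMk hγ).aemeasurable]
    exact hFi
  have : IsProbabilityMeasure (P.map X) := Measure.isProbabilityMeasure_map hX.aemeasurable
  have hXi' : Integrable (fun x : ℝ => x) (P.map X) :=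
    (integrable_map_measure aestronglyMeasurable_id hX.aemeasurable).2 hXi
  have hψl : LipschitzWith (Real.exp (K * |b|)).toNNReal (fun x => ψ x b) :=
    LipschitzWith.of_dist_le_mul fun x y => by
      rw [Real.dist_eq, Real.dist_eq, Real.coe_toNNReal _ (Real.exp_pos _).le, mul_comm]
      exact hψ.abs_sub_le hv y x b
  have hfψ : LipschitzWith _ (fun x => f (ψ x b)) := hf.comp hψl
  have h1 : ∫ ω, f (X ω + G (X ω, γ ω) * b) ∂P =
      ∫ x, ∫ m, F (x, m) ∂(gaussianReal 0 1) ∂(P.map X) := by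
    rw [← integral_prod F hFi', ← hmap,
      integral_map (hX.prodMk hγ).aemeasurable hFm.aestronglyMeasurable]
  have h2 : ∫ ω, f (ψ (X ω) b) ∂P = ∫ x, f (ψ x b) ∂(P.map X) := by
    rw [integral_map hX.aemeasurable hfψ.continuous.aestronglyMeasurable]
  have h3 : ∫ ω, (1 + |X ω|) ∂P = ∫ x, (1 + |x|) ∂(P.map X) := by
    rw [integral_map hX.aemeasurable (by fun_prop)]
  rw [h1, h2, h3, ← integral_sub hFi'.integral_prod_left (LipschitzWith.integrable_comp hfψ hXi'),
    ← integral_const_mul, ← Real.norm_eq_abs]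
  exact norm_integral_le_of_norm_le (((integrable_const _).add hXi'.abs).const_mul _)
    (ae_of_all _ hC)

variable {γ : ℕ → Ω → ℝ}

theorem IsNoisyCoeff.integrable_scheme (hG : IsNoisyCoeff G v A) (hv : LipschitzWith K v)
    (hγ : ∀ n, Measurable (γ n)) (hlaw : ∀ n, P.map (γ n) = gaussianReal 0 1) (x₀ : ℝ) (b : ℕ → ℝ)
    (n : ℕ) : Integrable (fun ω => scheme G x₀ b (fun k => γ k ω) n) P := by
  induction n with
  | zero => exact integrable_const x₀
  | succ n ih =>
    exact ih.add ((hG.integrable_comp hv (measurable_scheme (b := fun k _ => b k) hG.measurable x₀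
      (fun _ _ => measurable_const) fun k _ => hγ k) ih (hγ n) (hlaw n)).mul_const (b n))

end Noise

/-- The weak error between the scheme and the flow evaluated at the driving path is controlled by
the quadratic variation of the path, with a constant depending only on the oscillation of the
path. -/
theorem IsNoisyCoeff.exists_weak_error_le {G : ℝ × ℝ → ℝ} {v v' : ℝ → ℝ} {A : ℝ} {K : ℝ≥0}
    (hG : IsNoisyCoeff G v A) (hv : IsCOneOne K v v') {ψ : ℝ → ℝ → ℝ} (hψ : IsFlow v ψ)
    {φ φ' : ℝ → ℝ} {L : ℝ≥0} (hφ : IsCOneOne L φ φ') (x₀ : ℝ) (S : ℝ≥0) :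
    ∃ C : ℝ, ∀ {Ω : Type*} [MeasurableSpace Ω] (P : Measure Ω) [IsProbabilityMeasure P]
      (γ : ℕ → Ω → ℝ), (∀ n, Measurable (γ n)) → iIndepFun γ P →
      (∀ n, P.map (γ n) = gaussianReal 0 1) → ∀ (p : ℕ → ℝ) (N : ℕ),
      (∀ k ≤ N, ∀ n ≤ N, |p n - p k| ≤ S) →
      ∑ n ∈ Finset.range N, (p (n + 1) - p n) ^ 2 ≤ 1 →
      |∫ ω, φ (scheme G x₀ (fun n => p (n + 1) - p n) (fun n => γ n ω) N) ∂P -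
        φ (ψ x₀ (p N - p 0))| ≤ C * ∑ n ∈ Finset.range N, (p (n + 1) - p n) ^ 2 := by
  obtain ⟨L₁, hL₁⟩ := hv.exists_isTestFun_comp_flow hψ isCOneOne_sqrt_one_add_sq S
  obtain ⟨L₂, hL₂⟩ := hv.exists_isTestFun_comp_flow hψ hφ S
  obtain ⟨C₁, hC₁⟩ := hG.exists_abs_integral_sub_le hv.lipschitz hψ L₁ S
  obtain ⟨C₂, hC₂⟩ := hG.exists_abs_integral_sub_le hv.lipschitz hψ L₂ S
  obtain ⟨D, hD⟩ := hψ.exists_abs_le hv.lipschitz S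
  refine ⟨C₂ * (D * 2 * (√(1 + x₀ ^ 2) * Real.exp (C₁ * (D * 2)))), ?_⟩
  intro Ω _ P _ γ hγ hi hlaw p N hp hsum
  set b : ℕ → ℝ := fun n => p (n + 1) - p n with hb
  set X : ℕ → Ω → ℝ := fun n ω => scheme G x₀ b (fun k => γ k ω) n with hX
  have hXm : ∀ n, Measurable (X n) := fun n => measurable_scheme (b := fun k _ => b k)
    hG.measurable x₀ (fun _ _ => measurable_const) fun k _ => hγ k
  have hXi : ∀ n, Integrable (X n) P := hG.integrable_scheme hv.lipschitz hγ hlaw x₀ b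
  have hstep : ∀ {f : ℝ → ℝ} {L' C' : ℝ≥0} (n : ℕ), n < N → IsTestFun L' f →
      (∀ x b : ℝ, |b| ≤ S → |∫ m, f (x + G (x, m) * b) ∂(gaussianReal 0 1) - f (ψ x b)| ≤
        C' * b ^ 2 * (1 + |x|)) →
      |∫ ω, f (X (n + 1) ω) ∂P - ∫ ω, f (ψ (X n ω) (b n)) ∂P| ≤
        C' * b n ^ 2 * ∫ ω, (1 + |X n ω|) ∂P := by
    intro f L' C' n hn hf hC'
    exact hG.abs_integral_step_sub_le hv.lipschitz hψ hf.lipschitz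
      (fun x => hC' x (b n) (hp n hn.le (n + 1) hn)) (hXm n) (hXi n) (hγ n) (hlaw n)
      (indepFun_scheme hγ hi hG.measurable x₀ b n)
  -- a Lyapunov function: undo the flow
  set a : ℕ → ℝ := fun n => ∫ ω, √(1 + ψ (X n ω) (p 0 - p n) ^ 2) ∂P with ha
  have hXa : ∀ n ≤ N, ∫ ω, (1 + |X n ω|) ∂P ≤ D * 2 * a n := by
    intro n hn
    rw [ha, ← integral_const_mul]
    refine integral_mono ((integrable_const _).add (hXi n).abs)
      ((LipschitzWith.integrable_comp (hL₁ _ (hp n hn 0 (Nat.zero_le _))).lipschitz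
        (hXi n)).const_mul _) fun ω => ?_
    refine (hD _ (hp n hn 0 (Nat.zero_le _)) (X n ω)).trans ?_
    rw [mul_assoc]
    have h1 : |ψ (X n ω) (p 0 - p n)| ≤ √(1 + ψ (X n ω) (p 0 - p n) ^ 2) :=
      Real.abs_le_sqrt (by linarith)
    have h2 : 1 ≤ √(1 + ψ (X n ω) (p 0 - p n) ^ 2) :=
      Real.one_le_sqrt.2 (by nlinarith [sq_nonneg (ψ (X n ω) (p 0 - p n))])
    gcongr
    linarith
  have ha0 : ∀ n, 0 ≤ a n := fun n => integral_nonneg fun ω => Real.sqrt_nonneg _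
  -- Flowing by b_n and then by p 0 - p (n + 1) is flowing by p 0 - p n, so the Lyapunov quantity
  -- changes only at order b_n². Without undoing the flow the change would be of order b_n, which
  -- need not be summable uniformly in N.
  have hasucc : ∀ n < N, a (n + 1) ≤ (1 + C₁ * (D * 2) * b n ^ 2) * a n := by
    intro n hn
    have h1 := hstep n hn (hL₁ (p 0 - p (n + 1)) (hp (n + 1) hn 0 (Nat.zero_le _)))
      (hC₁ _ (hL₁ (p 0 - p (n + 1)) (hp (n + 1) hn 0 (Nat.zero_le _))))
    simp only [hψ.flow_add hv.lipschitz] at h1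
    have h2 : b n + (p 0 - p (n + 1)) = p 0 - p n := by simp only [hb]; ring
    rw [h2] at h1
    have h3 := (abs_le.1 h1).2
    have h4 := mul_le_mul_of_nonneg_left (hXa n hn.le)
      (by positivity : (0 : ℝ) ≤ C₁ * b n ^ 2)
    have h5 : a (n + 1) - a n ≤ C₁ * b n ^ 2 * ∫ ω, (1 + |X n ω|) ∂P := h3
    linarith
  have hprod : ∀ n ≤ N, a n ≤
      √(1 + x₀ ^ 2) * Real.exp (C₁ * (D * 2) * ∑ k ∈ Finset.range n, b k ^ 2) := by
    intro n
    induction n with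
    | zero => intro _; simp [ha, hX, scheme, hψ.zero]
    | succ n ih =>
      intro hn
      have h1 := ih (by omega)
      rw [Finset.sum_range_succ, mul_add, Real.exp_add]
      calc a (n + 1) ≤ (1 + C₁ * (D * 2) * b n ^ 2) * a n := hasucc n hn
        _ ≤ Real.exp (C₁ * (D * 2) * b n ^ 2) * (√(1 + x₀ ^ 2) *
            Real.exp (C₁ * (D * 2) * ∑ k ∈ Finset.range n, b k ^ 2)) := by
          refine mul_le_mul ?_ h1 (ha0 n) (Real.exp_pos _).le
          linarith [Real.add_one_le_exp (C₁ * (D * 2) * b n ^ 2)]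
        _ = _ := by ring
  have hmoment : ∀ n ≤ N, ∫ ω, (1 + |X n ω|) ∂P ≤
      D * 2 * (√(1 + x₀ ^ 2) * Real.exp (C₁ * (D * 2))) := by
    intro n hn
    refine (hXa n hn).trans ?_
    gcongr
    refine (hprod n hn).trans ?_
    -- The bound 1 on the quadratic variation makes the exponential a constant.
    have h1 : ∑ k ∈ Finset.range n, b k ^ 2 ≤ 1 :=
      (Finset.sum_le_sum_of_subset_of_nonneg (Finset.range_mono hn)
        fun k _ _ => sq_nonneg _).trans hsum
    have h2 : C₁ * (D * 2) * ∑ k ∈ Finset.range n, b k ^ 2 ≤ (C₁ * (D * 2) : ℝ) :=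
      mul_le_of_le_one_right (by positivity) h1
    exact mul_le_mul_of_nonneg_left (Real.exp_le_exp.2 h2) (Real.sqrt_nonneg _)
  -- telescoping along the flow
  set u : ℕ → ℝ := fun n => ∫ ω, φ (ψ (X n ω) (p N - p n)) ∂P with hu
  have husucc : ∀ n < N, |u (n + 1) - u n| ≤
      C₂ * (D * 2 * (√(1 + x₀ ^ 2) * Real.exp (C₁ * (D * 2)))) * b n ^ 2 := by
    intro n hn
    have h1 := hstep n hn (hL₂ (p N - p (n + 1)) (hp (n + 1) hn N le_rfl))
      (hC₂ _ (hL₂ (p N - p (n + 1)) (hp (n + 1) hn N le_rfl)))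
    simp only [hψ.flow_add hv.lipschitz] at h1
    have h2 : b n + (p N - p (n + 1)) = p N - p n := by simp only [hb]; ring
    rw [h2] at h1
    refine h1.trans ?_
    rw [mul_right_comm]
    gcongr
    exact hmoment n hn.le
  have huN : u N = ∫ ω, φ (X N ω) ∂P := by simp [hu, hψ.zero]
  have hu0 : u 0 = φ (ψ x₀ (p N - p 0)) := by simp [hu, hX, scheme]
  rw [← hu0, ← huN, ← Finset.sum_range_sub, Finset.mul_sum]
  refine (Finset.abs_sum_le_sum_abs _ _).trans (Finset.sum_le_sum fun n hn => ?_)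
  exact husucc n (Finset.mem_range.1 hn)

/-! ### The two schemes as instances of the recursion -/

theorem IsAdmissibleCoeff.exists_isNoisyCoeff {g : ℝ × ℝ → ℝ} (hg : IsAdmissibleCoeff g) :
    ∃ A, IsNoisyCoeff g (averagedCoeff g) A := by
  obtain ⟨K, hK, -⟩ := hg.exists_lipschitz
  have hint : ∀ x, Integrable (fun m => g (x, m)) (gaussianReal 0 1) :=
    integrable_of_linear_growth hK.continuous.measurable (abs_le_of_lipschitz hK)
  have hi1 : Integrable (fun m : ℝ => 1 + |m|) (gaussianReal 0 1) :=
    memLp_one_add_abs.integrable (by norm_num)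
  have hc : 1 ≤ ∫ m : ℝ, (1 + |m|) ∂(gaussianReal 0 1) := by
    have := integral_mono (μ := gaussianReal 0 1) (integrable_const (1 : ℝ)) hi1
      fun m => by simp
    simpa using this
  refine ⟨K * ∫ m : ℝ, (1 + |m|) ∂(gaussianReal 0 1), hK.continuous.measurable, fun x m => ?_,
    fun x => rfl⟩
  have h1 : g (x, m) - averagedCoeff g x =
      ∫ m', (g (x, m) - g (x, m')) ∂(gaussianReal 0 1) := by
    rw [integral_sub (integrable_const _) (hint x), averagedCoeff]
    simp
  rw [h1, ← Real.norm_eq_abs, mul_right_comm, ← integral_const_mul]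
  refine norm_integral_le_of_norm_le (hi1.const_mul _) (ae_of_all _ fun m' => ?_)
  have h2 := hK.dist_le_mul (x, m) (x, m')
  rw [dist_eq_norm, Prod.dist_eq, dist_self, max_eq_right dist_nonneg, Real.dist_eq] at h2
  refine h2.trans ?_
  rw [mul_assoc]
  gcongr
  -- This yields |m - m'| ≤ (1 + |m|) (1 + |m'|), which separates the variables.
  have h3 := abs_sub m m'
  nlinarith [abs_nonneg m, abs_nonneg m']

/-- This makes the averaged Euler scheme a noiseless instance of the recursion, covered by the same
weak error bound. -/
theorem isNoisyCoeff_comp_fst {v : ℝ → ℝ} (hv : Measurable v) :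
    IsNoisyCoeff (fun z => v z.1) v 0 where
  measurable := hv.comp measurable_fst
  abs_sub_le x m := by simp
  integral_eq x := by simp

section Schemes

variable {Ω : Type*} (g : ℝ × ℝ → ℝ) (β B : ℝ≥0 → Ω → ℝ) (x₀ : ℝ) (Δt : ℝ≥0)

theorem limitScheme_eq_scheme (n : ℕ) (ω : Ω) : limitScheme g β B x₀ Δt n ω =
    scheme g x₀ (fun k => increment β Δt k ω) (fun k => normalizedIncrement B Δt k ω) n := by
  induction n with
  | zero => rfl
  | succ n ih => rw [limitScheme, scheme, ih]

theorem averagedScheme_eq_scheme (m : ℕ → ℝ) (n : ℕ) (ω : Ω) : averagedScheme g β x₀ Δt n ω =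
    scheme (fun z => averagedCoeff g z.1) x₀ (fun k => increment β Δt k ω) m n := by
  induction n with
  | zero => rfl
  | succ n ih => rw [averagedScheme, scheme, ih]

end Schemes

/-- The quadratic variation of a path along the uniform grid of step `Δt`. -/
def gridVariation {Ω : Type*} (β : ℝ≥0 → Ω → ℝ) (Δt : ℝ≥0) (N : ℕ) (ω : Ω) : ℝ :=
  ∑ n ∈ Finset.range N, increment β Δt n ω ^ 2

theorem gridVariation_nonneg {Ω : Type*} (β : ℝ≥0 → Ω → ℝ) (Δt : ℝ≥0) (N : ℕ) (ω : Ω) :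
    0 ≤ gridVariation β Δt N ω :=
  Finset.sum_nonneg fun _ _ => sq_nonneg _

/-! ### Conditioning on an independent process -/

/-- Independence makes the conditional law of V given U a constant kernel. -/
theorem condExp_comp_ae_eq_integral_of_indepFun {Ω E F : Type*} [MeasurableSpace Ω]
    {P : Measure Ω} [IsProbabilityMeasure P] [mE : MeasurableSpace E] [MeasurableSpace F]
    [StandardBorelSpace F] [Nonempty F] {U : Ω → E} {V : Ω → F} (hU : Measurable U)
    (hV : Measurable V) (hind : IndepFun U V P) {f : E × F → ℝ} (hf : Measurable f)
    (hi : Integrable (fun ω => f (U ω, V ω)) P) :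
    P[fun ω => f (U ω, V ω) | mE.comap U] =ᵐ[P] fun ω => ∫ ω', f (U ω, V ω') ∂P := by
  have : IsProbabilityMeasure (P.map V) := Measure.isProbabilityMeasure_map hV.aemeasurable
  have h1 : condDistrib V U P =ᵐ[P.map U] Kernel.const E (P.map V) := by
    refine condDistrib_ae_eq_of_measure_eq_compProd U hV.aemeasurable ?_
    rw [Measure.compProd_const]
    exact (indepFun_iff_map_prod_eq_prod_map_map hU.aemeasurable hV.aemeasurable).1 hind
  filter_upwards [condExp_prod_ae_eq_integral_condDistrib hU hV.aemeasurable
    hf.stronglyMeasurable hi, ae_of_ae_map hU.aemeasurable h1] with ω h2 h3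
  rw [h2, h3, Kernel.const_apply]
  exact integral_map hV.aemeasurable (hf.comp measurable_prodMk_left).aestronglyMeasurable

theorem generatedSigma_eq_comap {Ω : Type*} (β : ℝ≥0 → Ω → ℝ) :
    generatedSigma β = MeasurableSpace.comap (fun ω t => β t ω) MeasurableSpace.pi := by
  simp only [MeasurableSpace.pi, MeasurableSpace.comap_iSup, MeasurableSpace.comap_comp]
  rfl

section Driving

variable {Ω : Type*} [MeasurableSpace Ω] {P : Measure Ω} {β B : ℝ≥0 → Ω → ℝ}

theorem measurable_increment (hβ : ∀ t, Measurable (β t)) (Δt : ℝ≥0) (n : ℕ) :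
    Measurable (increment β Δt n) :=
  (hβ _).sub (hβ _)

theorem measurable_normalizedIncrement (hB : ∀ t, Measurable (B t)) (Δt : ℝ≥0) (n : ℕ) :
    Measurable (normalizedIncrement B Δt n) :=
  (measurable_increment hB Δt n).const_mul _

theorem condExp_limitScheme_ae_eq [IsProbabilityMeasure P] (hβ : ∀ t, Measurable (β t))
    (hB : ∀ t, Measurable (B t)) (hind : IndepFun (fun ω t => β t ω) (fun ω t => B t ω) P)
    {g : ℝ × ℝ → ℝ} (hg : Measurable g) (x₀ : ℝ) (Δt : ℝ≥0) (N : ℕ) {φ : ℝ → ℝ}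
    (hφ : Measurable φ) {c : ℝ} (hc : ∀ x, |φ x| ≤ c) :
    P[fun ω => φ (limitScheme g β B x₀ Δt N ω) | generatedSigma β] =ᵐ[P]
      fun ω => ∫ ω', φ (scheme g x₀ (fun k => increment β Δt k ω)
        (fun k => normalizedIncrement B Δt k ω') N) ∂P := by
  have hmeas : ∀ t : ℝ≥0, Measurable fun p : ℝ≥0 → ℝ => p t := fun t => measurable_pi_apply t
  set U : Ω → ℝ≥0 → ℝ := fun ω t => β t ω with hU
  -- Keeping only a sequence of noises puts V in a standard Borel space, as conditional
  -- distributions require; the space of all functions on `ℝ≥0` would not do.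
  set V : Ω → ℕ → ℝ := fun ω k => normalizedIncrement B Δt k ω with hV
  set incr : ℝ≥0 → (ℝ≥0 → ℝ) → ℝ := fun t p => p t with hincr
  set f : (ℝ≥0 → ℝ) × (ℕ → ℝ) → ℝ := fun z =>
    φ (scheme g x₀ (fun k => increment incr Δt k z.1) z.2 N) with hf
  have hUm : Measurable U := measurable_pi_lambda _ hβ
  have hVm : Measurable V := measurable_pi_lambda _ (measurable_normalizedIncrement hB Δt)
  have hUV : IndepFun U V P := hind.comp (φ := id)
    (ψ := fun p k => normalizedIncrement incr Δt k p) measurable_id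
    (measurable_pi_lambda _ (measurable_normalizedIncrement hmeas Δt))
  have hfm : Measurable f := hφ.comp (measurable_scheme hg x₀
    (b := fun k (z : (ℝ≥0 → ℝ) × (ℕ → ℝ)) => increment incr Δt k z.1) (m := fun k z => z.2 k)
    (fun k _ => (measurable_increment hmeas Δt k).comp measurable_fst)
    (fun k _ => (measurable_pi_apply k).comp measurable_snd))
  have hfi : Integrable (fun ω => f (U ω, V ω)) P :=
    Integrable.of_bound (hfm.comp (hUm.prodMk hVm)).aestronglyMeasurable c
      (ae_of_all _ fun ω => hc _)
  have := condExp_comp_ae_eq_integral_of_indepFun hUm hVm hUV hfm hfi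
  rw [generatedSigma_eq_comap]
  have hcongr : (fun ω => φ (limitScheme g β B x₀ Δt N ω)) = fun ω => f (U ω, V ω) :=
    funext fun ω => congrArg φ (limitScheme_eq_scheme g β B x₀ Δt N ω)
  rw [hcongr]
  exact this

/-! ### The driving noises -/

theorem iIndepFun_normalizedIncrement (hB : IsPreBrownianReal B P) (Δt : ℝ≥0) :
    iIndepFun (normalizedIncrement B Δt) P := by
  have hmono : Monotone fun n : ℕ => (n : ℝ≥0) * Δt := fun a b hab => by
    dsimp only
    gcongr
  have h := (hB.hasIndepIncrements.nat hmono).comp (fun _ x => (√(Δt : ℝ))⁻¹ * x)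
    fun _ => measurable_const_mul _
  refine h.congr fun n => ae_of_all _ fun ω => ?_
  simp [normalizedIncrement, increment]

theorem map_normalizedIncrement (hB : IsPreBrownianReal B P) (hBm : ∀ t, Measurable (B t))
    {Δt : ℝ≥0} (hΔt : 0 < Δt) (n : ℕ) :
    P.map (normalizedIncrement B Δt n) = gaussianReal 0 1 := by
  have h1 := (hB.hasLaw_sub ((n + 1) * Δt) (n * Δt)).map_eq
  have h2 : nndist (((n + 1) * Δt : ℝ≥0) : ℝ) ((n * Δt : ℝ≥0) : ℝ) = Δt := by
    ext
    rw [coe_nndist, Real.dist_eq]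
    push_cast
    rw [add_mul, one_mul, add_sub_cancel_left, abs_of_nonneg Δt.coe_nonneg]
  replace h1 := h1.trans (congrArg (gaussianReal 0) h2)
  have h3 : normalizedIncrement B Δt n =
      (fun x => (√(Δt : ℝ))⁻¹ * x) ∘ (B ((n + 1) * Δt) - B (n * Δt)) := rfl
  rw [h3, ← Measure.map_map (measurable_const_mul _) ((hBm _).sub (hBm _)), h1,
    gaussianReal_map_const_mul]
  congr 1
  · simp
  · ext
    have : (Δt : ℝ) ≠ 0 := by exact_mod_cast hΔt.ne'
    push_cast
    rw [inv_pow, Real.sq_sqrt Δt.coe_nonneg, inv_mul_cancel₀ this]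

theorem IsFractionalBrownian.integral_sub_sq [IsProbabilityMeasure P] {H : ℝ} (hH : 0 < H)
    (hβ : IsFractionalBrownian H β P) (s t : ℝ≥0) :
    ∫ ω, (β t ω - β s ω) ^ 2 ∂P = |(t : ℝ) - s| ^ (2 * H) := by
  have hm : ∀ t, MemLp (β t) 2 P := fun t => (hβ.gaussian.hasGaussianLaw_eval t).memLp_two
  have hint : ∀ t, Integrable (β t) P := fun t => (hm t).integrable (by norm_num)
  have hvar : ∀ t : ℝ≥0, variance (β t) P = (t : ℝ) ^ (2 * H) := fun t => by
    rw [← covariance_self (hβ.measurable t).aemeasurable, hβ.covariance_eq, sub_self, abs_zero,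
      Real.zero_rpow (by positivity)]
    ring
  have h0 : ∫ ω, (β t ω - β s ω) ∂P = 0 := by
    rw [integral_sub (hint t) (hint s), hβ.centered, hβ.centered, sub_zero]
  rw [← variance_of_integral_eq_zero (X := fun ω => β t ω - β s ω)
      ((hβ.measurable t).sub (hβ.measurable s)).aemeasurable h0,
    variance_fun_sub (hm t) (hm s), hvar, hvar, hβ.covariance_eq, abs_sub_comm]
  ring

theorem IsFractionalBrownian.integrable_increment_sq {H : ℝ} (hβ : IsFractionalBrownian H β P)
    (Δt : ℝ≥0) (n : ℕ) : Integrable (fun ω => increment β Δt n ω ^ 2) P :=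
  ((hβ.gaussian.hasGaussianLaw_eval _).memLp_two.sub
    (hβ.gaussian.hasGaussianLaw_eval _).memLp_two).integrable_sq

theorem IsFractionalBrownian.integral_gridVariation [IsProbabilityMeasure P] {H : ℝ} (hH : 0 < H)
    (hβ : IsFractionalBrownian H β P) (Δt : ℝ≥0) (N : ℕ) :
    ∫ ω, gridVariation β Δt N ω ∂P = N * (Δt : ℝ) ^ (2 * H) := by
  simp only [gridVariation]
  rw [integral_finsetSum _ fun n _ => hβ.integrable_increment_sq Δt n]
  have : ∀ n ∈ Finset.range N, ∫ ω, increment β Δt n ω ^ 2 ∂P = (Δt : ℝ) ^ (2 * H) := by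
    intro n _
    simp only [increment]
    rw [hβ.integral_sub_sq hH]
    push_cast
    rw [add_mul, one_mul, add_sub_cancel_left, abs_of_nonneg Δt.coe_nonneg]
  rw [Finset.sum_congr rfl this]
  simp

/-- The expression equals T^(2H) N^(-(2H - 1)), whose exponent is negative because H > 1/2. -/
theorem tendsto_nat_mul_div_rpow {H : ℝ} (hH : 1 / 2 < H) (T : ℝ≥0) :
    Tendsto (fun N : ℕ => (N : ℝ) * ((T / N : ℝ≥0) : ℝ) ^ (2 * H)) atTop (𝓝 0) := by
  have h1 : Tendsto (fun N : ℕ => (T : ℝ) ^ (2 * H) * (N : ℝ) ^ (-(2 * H - 1))) atTop (𝓝 0) := by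
    have := ((tendsto_rpow_neg_atTop (by linarith : 0 < 2 * H - 1)).comp
      tendsto_natCast_atTop_atTop).const_mul ((T : ℝ) ^ (2 * H))
    rwa [mul_zero] at this
  refine h1.congr' ?_
  filter_upwards [eventually_gt_atTop 0] with N hN
  have hN' : (0 : ℝ) < N := by exact_mod_cast hN
  push_cast
  rw [Real.div_rpow T.coe_nonneg hN'.le, neg_sub, Real.rpow_sub hN', Real.rpow_one]
  ring

theorem IsFractionalBrownian.tendstoInMeasure_gridVariation [IsProbabilityMeasure P] {H : ℝ}
    (hH : 1 / 2 < H) (hβ : IsFractionalBrownian H β P) (T : ℝ≥0) :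
    TendstoInMeasure P (fun N : ℕ => gridVariation β (T / N) N) atTop (fun _ => 0) := by
  have hint : ∀ N : ℕ, Integrable (gridVariation β (T / N) N) P := fun N =>
    integrable_finsetSum _ fun n _ => hβ.integrable_increment_sq _ n
  refine tendstoInMeasure_of_tendsto_eLpNorm (p := 1) one_ne_zero
    (fun N => (hint N).aestronglyMeasurable) aestronglyMeasurable_const ?_
  have h1 : ∀ N : ℕ, eLpNorm (gridVariation β (T / N) N - fun _ => 0) 1 P =
      ENNReal.ofReal ((N : ℝ) * ((T / N : ℝ≥0) : ℝ) ^ (2 * H)) := fun N => by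
    have h0 : (gridVariation β (T / N) N - fun _ => 0) = gridVariation β (T / N) N := by
      ext ω; simp
    rw [h0, eLpNorm_one_eq_lintegral_enorm, ← ofReal_integral_norm_eq_lintegral_enorm (hint N),
      ← hβ.integral_gridVariation (by linarith)]
    congr 1
    exact integral_congr_ae (ae_of_all _ fun ω => abs_of_nonneg (gridVariation_nonneg _ _ _ _))
  simp only [h1]
  simpa using ENNReal.tendsto_ofReal (tendsto_nat_mul_div_rpow hH T)

end Driving

/-! ### Pathwise comparison of the two schemes -/

theorem gridVariation_eq_sum {Ω : Type*} (β : ℝ≥0 → Ω → ℝ) (Δt : ℝ≥0) (N : ℕ) (ω : Ω) :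
    gridVariation β Δt N ω =
      ∑ n ∈ Finset.range N, (β ((n + 1 : ℕ) * Δt) ω - β (n * Δt) ω) ^ 2 := by
  simp [gridVariation, increment]

/-- Along a continuous path, the difference between the averaged value of the limiting scheme and
the Euler scheme is controlled by the quadratic variation of the path along the grid. -/
theorem exists_abs_integral_scheme_sub_le {Ω : Type*} [MeasurableSpace Ω] {P : Measure Ω}
    [IsProbabilityMeasure P] {β B : ℝ≥0 → Ω → ℝ} (hB : IsPreBrownianReal B P)
    (hBm : ∀ t, Measurable (B t)) {g : ℝ × ℝ → ℝ} (hg : IsAdmissibleCoeff g) (x₀ : ℝ) {T : ℝ≥0}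
    (hT : 0 < T) {φ : ℝ → ℝ} (hφ : IsCb 3 φ) {ω : Ω} (hω : Continuous fun t => β t ω) :
    ∃ C : ℝ, ∀ N : ℕ, 0 < N → gridVariation β (T / N) N ω ≤ 1 →
      |∫ ω', φ (scheme g x₀ (fun k => increment β (T / N) k ω)
        (fun k => normalizedIncrement B (T / N) k ω') N) ∂P -
          φ (averagedScheme g β x₀ (T / N) N ω)| ≤ C * gridVariation β (T / N) N ω := by
  obtain ⟨K, v', hv⟩ := hg.exists_isCOneOne_averagedCoeff
  obtain ⟨ψ, hψ⟩ := exists_isFlow hv.lipschitz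
  obtain ⟨A, hA⟩ := hg.exists_isNoisyCoeff
  obtain ⟨L, hL⟩ := hφ.exists_isCOneOne
  obtain ⟨R, hR⟩ := (isCompact_Icc (a := (0 : ℝ≥0)) (b := T)).exists_bound_of_continuousOn
    hω.continuousOn
  -- A path bounded by R on [0, T] oscillates there by at most 2R, whatever the grid.
  obtain ⟨C₁, hC₁⟩ := hA.exists_weak_error_le hv hψ hL x₀ (2 * R).toNNReal
  obtain ⟨C₂, hC₂⟩ := (isNoisyCoeff_comp_fst hv.lipschitz.continuous.measurable).exists_weak_error_le
    hv hψ hL x₀ (2 * R).toNNReal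
  refine ⟨C₁ + C₂, fun N hN hle => ?_⟩
  -- A positive step is what makes the normalized increments standard Gaussian.
  have hΔ : 0 < T / N := div_pos hT (by exact_mod_cast hN)
  set p : ℕ → ℝ := fun n => β (n * (T / N)) ω with hp
  have hincr : (fun k => increment β (T / N) k ω) = fun k => p (k + 1) - p k := by
    ext k; simp [hp, increment]
  have hmem : ∀ n ≤ N, |p n| ≤ R := fun n hn => by
    refine hR _ ⟨zero_le, ?_⟩
    have hN' : (0 : ℝ≥0) < N := by exact_mod_cast hN
    have hn' : (n : ℝ≥0) ≤ N := by exact_mod_cast hn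
    calc (n : ℝ≥0) * (T / N) ≤ N * (T / N) := by gcongr
      _ = T := by field_simp
  have hosc : ∀ k ≤ N, ∀ n ≤ N, |p n - p k| ≤ ((2 * R).toNNReal : ℝ) := fun k hk n hn => by
    refine le_trans ?_ (Real.le_coe_toNNReal _)
    have := abs_sub (p n) (p k)
    linarith [hmem n hn, hmem k hk]
  rw [gridVariation_eq_sum] at hle ⊢
  have h1 := hC₁ P (normalizedIncrement B (T / N)) (measurable_normalizedIncrement hBm _)
    (iIndepFun_normalizedIncrement hB _) (map_normalizedIncrement hB hBm hΔ) p N hosc hle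
  have h2 := hC₂ P (normalizedIncrement B (T / N)) (measurable_normalizedIncrement hBm _)
    (iIndepFun_normalizedIncrement hB _) (map_normalizedIncrement hB hBm hΔ) p N hosc hle
  -- The noiseless scheme ignores the noise, so its integral is that of a constant; the common flow
  -- value then cancels by the triangle inequality.
  have h3 : ∀ ω', scheme (fun z => averagedCoeff g z.1) x₀ (fun k => p (k + 1) - p k)
      (fun n => normalizedIncrement B (T / N) n ω') N = averagedScheme g β x₀ (T / N) N ω :=
    fun ω' => by rw [averagedScheme_eq_scheme g β x₀ (T / N)
      (fun n => normalizedIncrement B (T / N) n ω'), hincr]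
  simp only [h3, integral_const, probReal_univ, one_smul] at h2
  rw [hincr, add_mul]
  rw [abs_sub_comm] at h2
  exact (abs_sub_le _ _ _).trans (add_le_add h1 h2)

end FBMAveraging
end

/-! ### Passage to the limit -/

open FBMAveraging

theorem proposition1 {Ω : Type*} [MeasurableSpace Ω] (P : Measure Ω) [IsProbabilityMeasure P]
    (H : ℝ) (hH : 1 / 2 < H) (hH1 : H < 1)
    (β B : ℝ≥0 → Ω → ℝ)
    (hβ : FBMAveraging.IsFractionalBrownian H β P)
    (hB : IsBrownianReal B P) (hBm : ∀ t, Measurable (B t))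
    (hindep : IndepFun (fun ω t => β t ω) (fun ω t => B t ω) P)
    (g : ℝ × ℝ → ℝ) (hg : FBMAveraging.IsAdmissibleCoeff g)
    (x₀ : ℝ) (T : ℝ≥0) (hT : 0 < T)
    (φ : ℝ → ℝ) (hφ : FBMAveraging.IsCb 3 φ) :
    Tendsto
      (fun N : ℕ => ∫ ω,
        |(P[fun ω' => φ (FBMAveraging.limitScheme g β B x₀ (T / N) N ω') |
            FBMAveraging.generatedSigma β]) ω
          - φ (FBMAveraging.averagedScheme g β x₀ (T / N) N ω)| ∂P)
      atTop (𝓝 0) := by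
  obtain ⟨c, hc⟩ : ∃ c : ℝ, ∀ x, |φ x| ≤ c := by simpa using hφ.2 0 (by norm_num)
  have hφm : Measurable φ := hφ.1.continuous.measurable
  have hcond := fun N : ℕ => condExp_limitScheme_ae_eq hβ.measurable hBm hindep
    hg.1.continuous.measurable x₀ (T / N) N hφm hc
  have hvm : Measurable fun z : ℝ × ℝ => averagedCoeff g z.1 := by
    obtain ⟨K, v', hv⟩ := hg.exists_isCOneOne_averagedCoeff
    exact hv.lipschitz.continuous.measurable.comp measurable_fst
  have havg : ∀ N : ℕ, Measurable (averagedScheme g β x₀ (T / N) N) := fun N => by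
    rw [funext (averagedScheme_eq_scheme g β x₀ (T / N) (fun _ => 0) N)]
    exact measurable_scheme hvm x₀ (n := N) (b := increment β (T / N)) (m := fun _ (_ : Ω) => 0)
      (fun k _ => measurable_increment hβ.measurable _ k) fun _ _ => measurable_const
  -- Every subsequence of step numbers has a further one along which the grid variation tends to 0
  -- almost surely; there the random constant C is harmless.
  refine tendsto_of_subseq_tendsto fun ns hns => ?_
  obtain ⟨ms, hms, hae⟩ := TendstoInMeasure.exists_seq_tendsto_ae
    (f := fun n => gridVariation β (T / ns n) (ns n)) (g := fun _ => 0)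
    fun ε hε => (hβ.tendstoInMeasure_gridVariation hH T ε hε).comp hns
  refine ⟨ms, ?_⟩
  have hN : Tendsto (fun k => ns (ms k)) atTop atTop := hns.comp hms.tendsto_atTop
  have hlim : Tendsto (fun k => ∫ ω,
      |(P[fun ω' => φ (limitScheme g β B x₀ (T / ns (ms k)) (ns (ms k)) ω') | generatedSigma β]) ω
        - φ (averagedScheme g β x₀ (T / ns (ms k)) (ns (ms k)) ω)| ∂P) atTop
      (𝓝 (∫ _, (0 : ℝ) ∂P)) := by
    refine tendsto_integral_of_dominated_convergence (fun _ => c + c) (fun k => ?_)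
      (integrable_const _) (fun k => ?_) ?_
    · exact (integrable_condExp.aestronglyMeasurable.sub
        (hφm.comp (havg _)).aestronglyMeasurable).norm
    · filter_upwards [hcond (ns (ms k))] with ω hω
      rw [Real.norm_eq_abs, abs_abs, hω]
      refine (abs_sub _ _).trans (add_le_add ?_ (hc _))
      simpa using norm_integral_le_of_norm_le_const (μ := P) (f := fun ω' =>
        φ (scheme g x₀ (fun i => increment β (T / ns (ms k)) i ω)
          (fun i => normalizedIncrement B (T / ns (ms k)) i ω') (ns (ms k))))
        (ae_of_all _ fun ω' => hc _)
    · filter_upwards [hae, hβ.cont, ae_all_iff.2 hcond] with ω hω hcont hω'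
      obtain ⟨C, hC⟩ := exists_abs_integral_scheme_sub_le hB.toIsPreBrownianReal hBm hg x₀ hT hφ
        hcont
      have h0 : Tendsto (fun k => C * gridVariation β (T / ns (ms k)) (ns (ms k)) ω) atTop
          (𝓝 0) := by simpa using hω.const_mul C
      refine squeeze_zero' (Eventually.of_forall fun _ => abs_nonneg _) ?_ h0
      filter_upwards [hω.eventually_le_const zero_lt_one, hN.eventually_gt_atTop 0] with k hk hk'
      rw [hω']
      exact hC _ hk' hk
  simpa using hlim
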